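/- Let $n\ge 1$, let $P\in[0,1]^{n\times n}$ be a (row-)stochastic matrix with rational entries, and let $C_1,\dots,C_p\subset\{1,\dots,n\}$ be the recurrent classes of the Markov chain with transition matrix $P$; for each $\ell$ let $\pi^{(\ell)}$ be the stationary distribution on $C_\ell$. For every $i$ let $M_i$ be the lowest common denominator of the entries of the $i$-th row of $P$, let $M$ be the lowest common denominator of all the entries of $P$, and put $D=M_1M_2\cdots M_n$. Let $r\in\mathbb{Z}^n$, and let $u\in\mathbb{R}^n$ be a bias vector of $(r,P)$, i.e. there is $\chi\in\mathbb{R}^n$ (which is then necessarily the gain vector, $\chi_i=\lim_{N\to\infty}\frac1N\mathbb{E}(r_{X_0}+\dots+r_{X_N}\mid X_0=i)$) such that $P\chi=\chi$ and $Pu=\chi+u-r$. Let $\|\cdot\|_\infty$ denote the supremum norm. (i) If for every $\ell\in\{1,\dots,p\}$ there exists $i_\ell\in C_\ell$ such that $u_{i_\ell}=0$, then $\|u\|_\infty\le 2\|r\|_\infty\, n\min\{D,M^{n-1}\}$. (ii) If $\sum_{i\in C_\ell}u_i\pi^{(\ell)}_i=0$ for all $\ell\in\{1,\dots,p\}$,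 then $\|u\|_\infty\le 4\|r\|_\infty\, n\min\{D,M^{n-1}\}$. -/

import Mathlib

/-- State `j` is accessible from state `i` for the Markov chain with transition matrix `P`:
for some `k ≥ 0` the `k`-step transition probability from `i` to `j` is positive. -/
def Accessible {n : ℕ} (P : Matrix (Fin n) (Fin n) ℚ) (i j : Fin n) : Prop :=
  ∃ k : ℕ, 0 < (P ^ k) i j

/-- Two states communicate if each one is accessible from the other. -/
def Communicates {n : ℕ} (P : Matrix (Fin n) (Fin n) ℚ) (i j : Fin n) : Prop :=
  Accessible P i j ∧ Accessible P j i

/-- A state `i` of a finite Markov chain is recurrent if the chain can get back to `i`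
from every state that is accessible from `i`. -/
def IsRecurrentState {n : ℕ} (P : Matrix (Fin n) (Fin n) ℚ) (i : Fin n) : Prop :=
  ∀ j, Accessible P i j → Accessible P j i

/-- A recurrent class is the communicating class of a recurrent state. -/
def IsRecurrentClass {n : ℕ} (P : Matrix (Fin n) (Fin n) ℚ) (C : Finset (Fin n)) : Prop :=
  ∃ i, IsRecurrentState P i ∧ ∀ j, j ∈ C ↔ Communicates P i j

/-- `π` is a stationary distribution on `C`: a probability vector indexed by `C` with
`πᵀ P_C = πᵀ`, where `P_C` is the submatrix of `P` with rows and columns from `C`.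
(If `C` is a recurrent class, there is exactly one such `π`.) -/
def IsStationaryOn {n : ℕ} (P : Matrix (Fin n) (Fin n) ℚ) (C : Finset (Fin n))
    (π : C → ℝ) : Prop :=
  π ∈ stdSimplex ℝ C ∧
    Matrix.vecMul π (Matrix.of fun i j : C => (P i j : ℝ)) = π

/-- The lowest common denominator of the entries in row `i` of `P`. -/
def rowDenom {n : ℕ} (P : Matrix (Fin n) (Fin n) ℚ) (i : Fin n) : ℕ :=
  Finset.univ.lcm fun j => (P i j).den

/-- The lowest common denominator of all the entries of `P`. -/
def commonDenom {n : ℕ} (P : Matrix (Fin n) (Fin n) ℚ) : ℕ :=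
  Finset.univ.lcm fun ij : Fin n × Fin n => (P ij.1 ij.2).den

/-- The product of the lowest common denominators of the rows of `P`. -/
def denomProd {n : ℕ} (P : Matrix (Fin n) (Fin n) ℚ) : ℕ :=
  ∏ i, rowDenom P i

/-- `u` is a bias vector of `(r, P)`: for some `χ` the pair `(χ, u)` solves the system
`P χ = χ`, `P u = χ + u - r`.  (Such a `χ` is necessarily the gain vector of `(r, P)`.) -/
def IsBias {n : ℕ} (P : Matrix (Fin n) (Fin n) ℚ) (r : Fin n → ℤ) (u : Fin n → ℝ) : Prop :=
  ∃ χ : Fin n → ℝ,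
    Matrix.mulVec (P.map fun x : ℚ => (x : ℝ)) χ = χ ∧
    Matrix.mulVec (P.map fun x : ℚ => (x : ℝ)) u = χ + u - fun i => (r i : ℝ)

/-!
A bias vector satisfies `u - P u = r - χ`, and `|r - χ| ≤ 2‖r‖` because the gain `χ` lies between
the extreme rewards (`gain_le`). By the maximum principle (`le_of_le_mulVec`), if every state
reaches a set `S`, then `|u|` is at most its maximum on `S` plus `2‖r‖` times the expected hitting
time of `S` (`abs_le_add_of_abs_sub_mulVec_le`).

The expected hitting time is a row sum over `Sᶜ` of the Green function `(1 - Q)⁻¹`, where `Q` is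
the chain killed on `S`. Its entry `(i, j)` is at most the diagonal entry `(j, j)`, which by
Cramer's rule is `det (1 - Q') / det (1 - Q)` with `Q'` killed on `S ∪ {j}`. This ratio is at least
`1`, so adding the states to `S` one at a time gives `0 < det (1 - Q) ≤ 1`
(`det_stopped_mem_Ioc`), and all entries are at most `1 / det (1 - Q)`. Multiplying the rows
outside `S` by their denominators makes the determinant a positive integer, hence
`1 / det (1 - Q) ≤ ∏ i ∈ Sᶜ, M i`, where `M i` is the denominator of row `i`. This is at most the
product `D` of all the `M i` and, with the common denominator `M`, since `#Sᶜ ≤ n - 1`, at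
most `M ^ (n - 1)`.

For the first bound take `S = {u = 0}`. For the second, apply the estimate inside a recurrent class
`C` to `u - u s`, with target `s ∈ C`: the oscillation `|u i - u s|` obeys the first bound, hence so
does `|u s|`, as `u` has mean zero on `C`. Then take for `S` the set of all recurrent states, which
doubles the bound.
-/

open Matrix Finset

/-! ### The maximum principle and the gain -/

section MaximumPrinciple

variable {ι : Type*} {p : Matrix ι ι ℝ}

/-- `S` can be reached from every state of `A` along transitions of positive probability. -/
def ReachableFrom (p : Matrix ι ι ℝ) (S : Finset ι) (A : Set ι) : Prop :=
  ∀ i ∈ A, ∃ s ∈ S, Relation.ReflTransGen (fun a b => 0 < p a b) i s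

lemma ReachableFrom.mono {S T : Finset ι} {A : Set ι} (hS : ReachableFrom p S A) (hST : S ⊆ T) :
    ReachableFrom p T A := fun i hi =>
  let ⟨s, hs, h⟩ := hS i hi
  ⟨s, hST hs, h⟩

variable [Fintype ι] [DecidableEq ι]

lemma mulVec_le_of_forall_pos_imp_le (hp : p ∈ rowStochastic ℝ ι) {h : ι → ℝ} {m : ℝ} {b : ι}
    (hle : ∀ l, 0 < p b l → h l ≤ m) : (p *ᵥ h) b ≤ m := by
  have hsum := sum_row_of_mem_rowStochastic hp b
  calc (p *ᵥ h) b = ∑ l, p b l * h l := rfl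
    _ ≤ ∑ l, p b l * m := by
        refine sum_le_sum fun l _ => ?_
        rcases (hp.1 b l).eq_or_lt with h0 | h0
        · simp [← h0]
        · exact mul_le_mul_of_nonneg_left (hle l h0) h0.le
    _ = m := by rw [← sum_mul, hsum, one_mul]

/-- If a weighted average attains its upper bound, every value with positive weight does. -/
lemma eq_of_le_mulVec (hp : p ∈ rowStochastic ℝ ι) {h : ι → ℝ} {m : ℝ} {b k : ι}
    (hle : ∀ l, 0 < p b l → h l ≤ m) (hm : m ≤ (p *ᵥ h) b) (hk : 0 < p b k) : h k = m := by
  refine (hle k hk).antisymm (not_lt.1 fun hlt => hm.not_gt ?_)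
  have hsum := sum_row_of_mem_rowStochastic hp b
  calc (p *ᵥ h) b = ∑ l, p b l * h l := rfl
    _ < ∑ l, p b l * m := by
        refine sum_lt_sum (fun l _ => ?_) ⟨k, mem_univ k, mul_lt_mul_of_pos_left hlt hk⟩
        rcases (hp.1 b l).eq_or_lt with h0 | h0
        · simp [← h0]
        · exact mul_le_mul_of_nonneg_left (hle l h0) h0.le
    _ = m := by rw [← sum_mul, hsum, one_mul]

/-- Maximum principle: a function on a closed set `A` that is subharmonic off `S` is bounded by
its values on `S`, provided that `S` is reachable. -/
lemma le_of_le_mulVec (hp : p ∈ rowStochastic ℝ ι) {A : Set ι} {S : Finset ι}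
    (hA : ∀ i ∈ A, ∀ j, 0 < p i j → j ∈ A) (hS : ReachableFrom p S A) {h : ι → ℝ} {c : ℝ}
    (hs : ∀ i ∈ A, i ∈ S → h i ≤ c) (hh : ∀ i ∈ A, i ∉ S → h i ≤ (p *ᵥ h) i) :
    ∀ i ∈ A, h i ≤ c := by
  intro i hi
  obtain ⟨a, haA, hmax⟩ := Set.exists_max_image A h (Set.toFinite A) ⟨i, hi⟩
  refine (hmax i hi).trans (not_lt.1 fun hlt => ?_)
  have key : ∀ j, Relation.ReflTransGen (fun a b => 0 < p a b) a j → j ∈ A ∧ h j = h a := by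
    intro j hj
    induction hj with
    | refl => exact ⟨haA, rfl⟩
    | @tail b k _ hbk ih =>
      obtain ⟨hbA, hb⟩ := ih
      have hbS : b ∉ S := fun hbS => (hs b hbA hbS).not_gt (hb ▸ hlt)
      exact ⟨hA b hbA k hbk, eq_of_le_mulVec hp (fun l hl => hmax l (hA b hbA l hl))
        (hb ▸ hh b hbA hbS) hbk⟩
  obtain ⟨s, hsS, has⟩ := hS a haA
  obtain ⟨hsA, hsa⟩ := key s has
  exact (hs s hsA hsS).not_gt (hsa ▸ hlt)

/-- The gain is at most the largest reward: at a state that maximizes `u` among the maximizers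
of `χ`, the equation `p u = χ + u - r` gives `χ ≤ r`. -/
lemma gain_le (hp : p ∈ rowStochastic ℝ ι) {χ u r : ι → ℝ} {R : ℝ} (hχ : p *ᵥ χ = χ)
    (hu : p *ᵥ u = χ + u - r) (hr : ∀ i, r i ≤ R) (i : ι) : χ i ≤ R := by
  obtain ⟨a, -, ha⟩ := exists_max_image univ χ ⟨i, mem_univ i⟩
  obtain ⟨b, hb, hbmax⟩ :=
    Set.exists_max_image {j | χ j = χ a} u (Set.toFinite _) ⟨a, rfl⟩
  have hclosed : ∀ k, 0 < p b k → χ k = χ a := fun k hk =>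
    eq_of_le_mulVec hp (fun l _ => ha l (mem_univ l)) (by rw [hχ]; exact hb.ge) hk
  have h1 : (p *ᵥ u) b ≤ u b :=
    mulVec_le_of_forall_pos_imp_le hp fun l hl => hbmax l (hclosed l hl)
  rw [hu] at h1
  simp only [Pi.sub_apply, Pi.add_apply] at h1
  have hb' : χ b = χ a := hb
  linarith [ha i (mem_univ i), hr b]

lemma abs_sub_gain_le (hp : p ∈ rowStochastic ℝ ι) {χ u r : ι → ℝ} {R : ℝ} (hχ : p *ᵥ χ = χ)
    (hu : p *ᵥ u = χ + u - r) (hr : ∀ i, |r i| ≤ R) (i : ι) : |r i - χ i| ≤ 2 * R := by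
  have h1 := gain_le hp hχ hu (fun i => (abs_le.1 (hr i)).2) i
  have h2 := gain_le (r := -r) (R := R) hp (χ := -χ) (u := -u) (by rw [mulVec_neg, hχ])
    (by rw [mulVec_neg, hu]; abel) (fun i => neg_le.1 (abs_le.1 (hr i)).1) i
  have h3 := abs_le.1 (hr i)
  simp only [Pi.neg_apply] at h2
  rw [abs_le]
  constructor <;> linarith

end MaximumPrinciple

/-! ### The Green function of the chain killed on a set -/

section StoppedChain

variable {ι : Type*} [DecidableEq ι] {p : Matrix ι ι ℝ}

/-- The matrix `1 - Q`, where `Q` is the transition matrix `p` of the chain killed on `S`, that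
is, with the rows indexed by `S` replaced by `0`. -/
def stopped (p : Matrix ι ι ℝ) (S : Finset ι) : Matrix ι ι ℝ :=
  of fun i => if i ∈ S then (1 : Matrix ι ι ℝ) i else (1 - p) i

lemma updateRow_stopped (S : Finset ι) (j : ι) :
    (stopped p S).updateRow j (Pi.single j 1) = stopped p (insert j S) := by
  ext a b
  by_cases h : a = j
  · subst h
    simp [stopped, one_apply, Pi.single_apply, eq_comm]
  · simp [stopped, h]

variable [Fintype ι]

lemma stopped_mulVec_of_mem {S : Finset ι} {i : ι} (hi : i ∈ S) (x : ι → ℝ) :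
    (stopped p S *ᵥ x) i = x i := by
  have h : (stopped p S *ᵥ x) i = ((1 : Matrix ι ι ℝ) *ᵥ x) i := by simp [stopped, mulVec, hi]
  rw [h, one_mulVec]

lemma stopped_mulVec_of_notMem {S : Finset ι} {i : ι} (hi : i ∉ S) (x : ι → ℝ) :
    (stopped p S *ᵥ x) i = x i - (p *ᵥ x) i := by
  have h : (stopped p S *ᵥ x) i = ((1 - p) *ᵥ x) i := by
    simp only [stopped, mulVec, of_apply, hi, if_false]
  rw [h, sub_mulVec, one_mulVec, Pi.sub_apply]

lemma stopped_univ : stopped p univ = 1 := by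
  ext i j; simp [stopped]

lemma nonneg_of_stopped_mulVec_nonneg (hp : p ∈ rowStochastic ℝ ι) {S : Finset ι}
    (hS : ReachableFrom p S Set.univ) {x : ι → ℝ} (hx : ∀ i, 0 ≤ (stopped p S *ᵥ x) i) (i : ι) :
    0 ≤ x i := by
  refine neg_nonpos.1 (le_of_le_mulVec (h := -x) hp (fun _ _ _ _ => trivial) hS ?_ ?_ i trivial)
  · intro i _ hi
    simpa [stopped_mulVec_of_mem hi] using hx i
  · intro i _ hi
    have := hx i
    rw [stopped_mulVec_of_notMem hi] at this
    rw [mulVec_neg, Pi.neg_apply, Pi.neg_apply]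
    linarith

lemma det_stopped_ne_zero (hp : p ∈ rowStochastic ℝ ι) {S : Finset ι}
    (hS : ReachableFrom p S Set.univ) : (stopped p S).det ≠ 0 := by
  intro h0
  obtain ⟨v, hv, h⟩ := exists_mulVec_eq_zero_iff.2 h0
  refine hv (funext fun i => le_antisymm ?_ ?_)
  · have := nonneg_of_stopped_mulVec_nonneg (x := -v) hp hS (by simp [mulVec_neg, h]) i
    simpa using this
  · exact nonneg_of_stopped_mulVec_nonneg hp hS (by simp [h]) i

lemma mulVec_single_one_apply (A : Matrix ι ι ℝ) (i j : ι) :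
    (A *ᵥ Pi.single j 1) i = A i j := by
  rw [mulVec_single_one, col_apply]

lemma stopped_mulVec_inv_mulVec (hp : p ∈ rowStochastic ℝ ι) {S : Finset ι}
    (hS : ReachableFrom p S Set.univ) (y : ι → ℝ) :
    stopped p S *ᵥ ((stopped p S)⁻¹ *ᵥ y) = y := by
  rw [mulVec_mulVec, mul_nonsing_inv _ (det_stopped_ne_zero hp hS).isUnit, one_mulVec]

/-- Entries of the Green function `(1 - Q)⁻¹` are nonnegative. -/
lemma inv_stopped_nonneg (hp : p ∈ rowStochastic ℝ ι) {S : Finset ι}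
    (hS : ReachableFrom p S Set.univ) (i j : ι) : 0 ≤ (stopped p S)⁻¹ i j := by
  rw [← mulVec_single_one_apply (stopped p S)⁻¹]
  refine nonneg_of_stopped_mulVec_nonneg hp hS (fun k => ?_) i
  rw [stopped_mulVec_inv_mulVec hp hS]
  exact (Pi.single_nonneg (α := fun _ : ι => ℝ)).2 zero_le_one k

/-- The expected number of visits to `j` is largest for the chain started at `j`. -/
lemma inv_stopped_le_diag (hp : p ∈ rowStochastic ℝ ι) {S : Finset ι}
    (hS : ReachableFrom p S Set.univ) (i j : ι) :
    (stopped p S)⁻¹ i j ≤ (stopped p S)⁻¹ j j := by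
  have hx : stopped p S *ᵥ ((stopped p S)⁻¹ *ᵥ Pi.single j 1) = Pi.single j 1 :=
    stopped_mulVec_inv_mulVec hp hS _
  have hjj := inv_stopped_nonneg hp hS j j
  simp only [← mulVec_single_one_apply (stopped p S)⁻¹] at hjj ⊢
  set x := (stopped p S)⁻¹ *ᵥ Pi.single j 1
  refine le_of_le_mulVec (S := insert j S) hp (fun _ _ _ _ => trivial)
    (hS.mono (subset_insert j S)) ?_ ?_ i trivial
  · intro k _ hk
    by_cases hkj : k = j
    · rw [hkj]
    · have h1 := congrFun hx k
      rw [stopped_mulVec_of_mem ((mem_insert.1 hk).resolve_left hkj), Pi.single_eq_of_ne hkj] at h1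
      rw [h1]
      exact hjj
  · intro k _ hk
    rw [mem_insert, not_or] at hk
    have h1 := congrFun hx k
    rw [stopped_mulVec_of_notMem hk.2, Pi.single_eq_of_ne hk.1] at h1
    linarith

lemma inv_stopped_diag (S : Finset ι) (j : ι) :
    (stopped p S)⁻¹ j j = (stopped p (insert j S)).det / (stopped p S).det := by
  rw [Matrix.inv_def, Matrix.smul_apply, adjugate_apply, updateRow_stopped, Ring.inverse_eq_inv',
    smul_eq_mul, div_eq_inv_mul]

lemma one_le_inv_stopped_diag (hp : p ∈ rowStochastic ℝ ι) {S : Finset ι}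
    (hS : ReachableFrom p S Set.univ) {j : ι} (hj : j ∉ S) : 1 ≤ (stopped p S)⁻¹ j j := by
  have h := congrFun (stopped_mulVec_inv_mulVec hp hS (Pi.single j 1)) j
  rw [stopped_mulVec_of_notMem hj, Pi.single_eq_same, mulVec_single_one] at h
  have h2 : 0 ≤ (p *ᵥ (stopped p S)⁻¹.col j) j :=
    nonneg_mulVec_of_mem_rowStochastic hp (fun i => inv_stopped_nonneg hp hS i j) j
  rw [col_apply] at h
  linarith

/-- Adding a state `j` to `S` multiplies the determinant by the expected number of visits to
`j`, which is at least `1`; once all states are in `S`, the determinant is `1`. -/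
lemma det_stopped_mem_Ioc (hp : p ∈ rowStochastic ℝ ι) {S : Finset ι}
    (hS : ReachableFrom p S Set.univ) : (stopped p S).det ∈ Set.Ioc (0 : ℝ) 1 := by
  induction hk : #Sᶜ generalizing S with
  | zero =>
    rw [card_eq_zero, compl_eq_empty_iff] at hk
    simp [hk, stopped_univ]
  | succ k ih =>
    obtain ⟨j, hj⟩ : Sᶜ.Nonempty := card_pos.1 (by omega)
    have hjS := mem_compl.1 hj
    obtain ⟨h0, h1⟩ := ih (hS.mono (subset_insert j S))
      (by rw [compl_insert, card_erase_of_mem hj, hk, Nat.add_sub_cancel])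
    have hv := one_le_inv_stopped_diag hp hS hjS
    rw [inv_stopped_diag] at hv
    have hpos : 0 < (stopped p S).det := by
      by_contra! hneg
      have := div_nonpos_of_nonneg_of_nonpos h0.le hneg
      linarith
    exact ⟨hpos, ((one_le_div hpos).1 hv).trans h1⟩

lemma inv_stopped_le (hp : p ∈ rowStochastic ℝ ι) {S : Finset ι}
    (hS : ReachableFrom p S Set.univ) (i j : ι) :
    (stopped p S)⁻¹ i j ≤ (stopped p S).det⁻¹ := by
  refine (inv_stopped_le_diag hp hS i j).trans ?_
  rw [inv_stopped_diag, div_eq_mul_inv]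
  exact mul_le_of_le_one_left (inv_nonneg.2 (det_stopped_mem_Ioc hp hS).1.le)
    (det_stopped_mem_Ioc hp (hS.mono (subset_insert j S))).2

/-- Clearing denominators row by row turns the determinant into a positive integer. -/
lemma inv_det_stopped_le_prod (hp : p ∈ rowStochastic ℝ ι) {S : Finset ι}
    (hS : ReachableFrom p S Set.univ) {d : ι → ℕ} (hd0 : ∀ i, 0 < d i)
    (hd : ∀ i j, ∃ z : ℤ, d i * p i j = z) :
    (stopped p S).det⁻¹ ≤ ∏ i ∈ Sᶜ, (d i : ℝ) := by
  choose z hz using hd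
  let v : ι → ℝ := fun i => if i ∈ S then 1 else d i
  let Z : Matrix ι ι ℤ := of fun i j =>
    if i ∈ S then (1 : Matrix ι ι ℤ) i j else d i * (1 : Matrix ι ι ℤ) i j - z i j
  have hZ : (of fun i j => v i * stopped p S i j) = Z.map (Int.cast : ℤ → ℝ) := by
    ext i j
    by_cases hi : i ∈ S
    · simp [v, Z, stopped, hi, one_apply, apply_ite (Int.cast : ℤ → ℝ)]
    · simp [v, Z, stopped, hi, one_apply, mul_sub, hz]
  have hprod : ∏ i, v i = ∏ i ∈ Sᶜ, (d i : ℝ) := by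
    rw [← prod_mul_prod_compl S v]
    rw [prod_congr rfl (g := fun _ => (1 : ℝ)) (fun i hi => by simp [v, hi]), prod_const_one,
      one_mul]
    exact prod_congr rfl fun i hi => by simp [v, mem_compl.1 hi]
  have hdet : (∏ i ∈ Sᶜ, (d i : ℝ)) * (stopped p S).det = (Z.det : ℝ) := by
    rw [← hprod, ← det_mul_column, hZ, Int.cast_det]
  have hpos := (det_stopped_mem_Ioc hp hS).1
  have hnn : (0 : ℝ) ≤ ∏ i ∈ Sᶜ, (d i : ℝ) := prod_nonneg fun i _ => Nat.cast_nonneg _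
  have hne : (∏ i ∈ Sᶜ, (d i : ℝ)) ≠ 0 := by
    rw [← hprod]
    refine prod_ne_zero_iff.2 fun i _ => ?_
    simp only [v]
    split_ifs with hi
    · exact one_ne_zero
    · exact Nat.cast_ne_zero.2 (hd0 i).ne'
  have hZpos : (0 : ℝ) < Z.det := by
    rw [← hdet]; exact mul_pos (hnn.lt_of_ne' hne) hpos
  have hone : (1 : ℝ) ≤ Z.det := by exact_mod_cast hZpos
  rw [inv_le_iff_one_le_mul₀ hpos, hdet]
  exact hone

/-- If `u` exceeds its one-step average by at most `K` off `S`, then it exceeds its values on `S`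
by at most `K` times the expected hitting time of `S`, which is a sum of `#Sᶜ` entries of the
Green function. -/
lemma le_add_of_sub_mulVec_le (hp : p ∈ rowStochastic ℝ ι) {A : Set ι} {S : Finset ι}
    (hA : ∀ i ∈ A, ∀ j, 0 < p i j → j ∈ A) (hS : ReachableFrom p S Set.univ) {u : ι → ℝ}
    {c K : ℝ} (hK : 0 ≤ K) (hs : ∀ i ∈ A, i ∈ S → u i ≤ c)
    (hu : ∀ i ∈ A, i ∉ S → u i - (p *ᵥ u) i ≤ K) :
    ∀ i ∈ A, u i ≤ c + K * (#Sᶜ * (stopped p S).det⁻¹) := by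
  let y : ι → ℝ := fun i => if i ∈ S then 0 else 1
  -- the vector of expected hitting times of `S`
  let w := (stopped p S)⁻¹ *ᵥ y
  have hw : stopped p S *ᵥ w = y := stopped_mulVec_inv_mulVec hp hS y
  have hw_le : ∀ i, w i ≤ #Sᶜ * (stopped p S).det⁻¹ := fun i => by
    calc w i = ∑ j, (stopped p S)⁻¹ i j * y j := rfl
      _ = ∑ j ∈ Sᶜ, (stopped p S)⁻¹ i j := by
          rw [compl_eq_univ_sdiff, ← filter_notMem_eq_sdiff, sum_filter]
          exact sum_congr rfl fun j _ => by by_cases hj : j ∈ S <;> simp [y, hj]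
      _ ≤ ∑ _j ∈ Sᶜ, (stopped p S).det⁻¹ := sum_le_sum fun j _ => inv_stopped_le hp hS i j
      _ = _ := by rw [sum_const, nsmul_eq_mul]
  intro i hi
  have key : (u - K • w) i ≤ c := by
    refine le_of_le_mulVec (S := S) hp hA (fun i _ => hS i trivial) ?_ ?_ i hi
    · intro k hk hkS
      have h1 := congrFun hw k
      rw [stopped_mulVec_of_mem hkS] at h1
      simpa [h1, y, hkS] using hs k hk hkS
    · intro k hk hkS
      have h1 := congrFun hw k
      rw [stopped_mulVec_of_notMem hkS] at h1
      have h2 := hu k hk hkS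
      have h3 : w k = 1 + (p *ᵥ w) k := by simp only [y, hkS, if_false] at h1; linarith
      simp only [mulVec_sub, mulVec_smul, Pi.sub_apply, Pi.smul_apply, smul_eq_mul, h3]
      linarith
  simp only [Pi.sub_apply, Pi.smul_apply, smul_eq_mul] at key
  linarith [mul_le_mul_of_nonneg_left (hw_le i) hK]

lemma abs_le_add_of_abs_sub_mulVec_le (hp : p ∈ rowStochastic ℝ ι) {A : Set ι} {S : Finset ι}
    (hA : ∀ i ∈ A, ∀ j, 0 < p i j → j ∈ A) (hS : ReachableFrom p S Set.univ) {u : ι → ℝ}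
    {c K : ℝ} (hK : 0 ≤ K) (hs : ∀ i ∈ A, i ∈ S → |u i| ≤ c)
    (hu : ∀ i ∈ A, i ∉ S → |u i - (p *ᵥ u) i| ≤ K) :
    ∀ i ∈ A, |u i| ≤ c + K * (#Sᶜ * (stopped p S).det⁻¹) := by
  intro i hi
  refine abs_le'.2 ⟨?_, ?_⟩
  · exact le_add_of_sub_mulVec_le hp hA hS hK (fun i hi h => (le_abs_self _).trans (hs i hi h))
      (fun i hi h => (le_abs_self _).trans (hu i hi h)) i hi
  · refine le_add_of_sub_mulVec_le (u := -u) hp hA hS hK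
      (fun i hi h => (neg_le_abs _).trans (hs i hi h)) (fun i hi h => ?_) i hi
    rw [mulVec_neg, Pi.neg_apply, Pi.neg_apply, ← neg_sub']
    exact (neg_le_abs _).trans (hu i hi h)

end StoppedChain

/-! ### Stationary distributions -/

/-- A stationary distribution is obtained from a left eigenvector `v` for the eigenvalue `1`:
termwise `|v| ≤ |v| q`, and both sides have the same sum, so `|v|` is invariant too. -/
lemma exists_stationary {κ : Type*} [Fintype κ] [DecidableEq κ] [Nonempty κ] {q : Matrix κ κ ℝ}
    (hq : q ∈ rowStochastic ℝ κ) : ∃ π ∈ stdSimplex ℝ κ, π ᵥ* q = π := by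
  have hdet : (1 - q).det = 0 :=
    exists_mulVec_eq_zero_iff.1 ⟨1, one_ne_zero, by rw [sub_mulVec, one_mulVec, hq.2, sub_self]⟩
  obtain ⟨v, hv0, hv⟩ := exists_vecMul_eq_zero_iff.2 hdet
  rw [vecMul_sub, vecMul_one, sub_eq_zero] at hv
  let a : κ → ℝ := fun i => |v i|
  have hle : ∀ j, a j ≤ (a ᵥ* q) j := fun j => by
    calc |v j| = |∑ i, v i * q i j| := by rw [congrFun hv j]; rfl
      _ ≤ ∑ i, |v i * q i j| := abs_sum_le_sum_abs _ _
      _ = ∑ i, |v i| * q i j :=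
          sum_congr rfl fun i _ => by rw [abs_mul, abs_of_nonneg (hq.1 i j)]
  have hsum : ∑ j, (a ᵥ* q) j = ∑ j, a j := by
    simp only [vecMul, dotProduct]
    rw [sum_comm]
    exact sum_congr rfl fun i _ => by rw [← mul_sum, sum_row_of_mem_rowStochastic hq, mul_one]
  have heq : a ᵥ* q = a := funext fun j =>
    ((sum_eq_sum_iff_of_le fun j _ => hle j).1 hsum.symm j (mem_univ j)).symm
  obtain ⟨i, hi⟩ := Function.ne_iff.1 hv0
  have hpos : 0 < ∑ j, a j :=
    sum_pos' (fun j _ => abs_nonneg (v j)) ⟨i, mem_univ i, abs_pos.2 hi⟩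
  refine ⟨(∑ j, a j)⁻¹ • a, ⟨fun j => ?_, ?_⟩, by rw [smul_vecMul, heq]⟩
  · exact mul_nonneg (inv_nonneg.2 hpos.le) (abs_nonneg _)
  · simp only [Pi.smul_apply, smul_eq_mul]
    rw [← mul_sum, inv_mul_cancel₀ hpos.ne']

/-! ### Recurrent classes and denominators of a rational chain -/

section RationalChain

variable {n : ℕ} {P : Matrix (Fin n) (Fin n) ℚ}

lemma cast_mem_rowStochastic (hP : P ∈ rowStochastic ℚ (Fin n)) :
    P.map (fun x : ℚ => (x : ℝ)) ∈ rowStochastic ℝ (Fin n) := by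
  rw [mem_rowStochastic_iff_sum] at hP ⊢
  refine ⟨fun i j => ?_, fun i => ?_⟩
  · exact Rat.cast_nonneg.2 (hP.1 i j)
  · simp only [Matrix.map_apply]
    exact_mod_cast hP.2 i

lemma accessible_iff_reflTransGen (hP : P ∈ rowStochastic ℚ (Fin n)) {i j : Fin n} :
    Accessible P i j ↔ Relation.ReflTransGen (fun a b => 0 < P a b) i j := by
  have hpow : ∀ k a b, 0 ≤ (P ^ k) a b := fun k => (pow_mem hP k).1
  constructor
  · rintro ⟨k, hk⟩
    induction k generalizing j with
    | zero =>
      by_cases hij : i = j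
      · rw [hij]
      · simp [hij] at hk
    | succ k ih =>
      rw [pow_succ, mul_apply] at hk
      obtain ⟨l, -, hl⟩ := exists_lt_of_sum_lt (f := fun _ => (0 : ℚ)) (by simpa using hk)
      have h1 : 0 < (P ^ k) i l := (hpow k i l).lt_of_ne' fun h => by simp [h] at hl
      exact (ih h1).tail ((hP.1 l j).lt_of_ne' fun h => by simp [h] at hl)
  · intro h
    induction h with
    | refl => exact ⟨0, by simp⟩
    | @tail b c _ hbc ih =>
      obtain ⟨k, hk⟩ := ih
      refine ⟨k + 1, ?_⟩
      rw [pow_succ, mul_apply]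
      exact sum_pos' (fun l _ => mul_nonneg (hpow k i l) (hP.1 l c))
        ⟨b, mem_univ b, mul_pos hk hbc⟩

lemma accessible_refl (i : Fin n) : Accessible P i i := ⟨0, by simp⟩

lemma Accessible.trans (hP : P ∈ rowStochastic ℚ (Fin n)) {i j k : Fin n} (h : Accessible P i j)
    (h' : Accessible P j k) : Accessible P i k := by
  rw [accessible_iff_reflTransGen hP] at h h' ⊢
  exact h.trans h'

lemma Accessible.reflTransGen_cast (hP : P ∈ rowStochastic ℚ (Fin n)) {i j : Fin n}
    (h : Accessible P i j) :
    Relation.ReflTransGen (fun a b => 0 < P.map (fun x : ℚ => (x : ℝ)) a b) i j :=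
  Relation.ReflTransGen.mono (fun _ _ h => Rat.cast_pos.2 h) _ _
    ((accessible_iff_reflTransGen hP).1 h)

/-- A state accessible from `i` with the fewest accessible states is recurrent. -/
lemma exists_accessible_isRecurrentState (hP : P ∈ rowStochastic ℚ (Fin n)) (i : Fin n) :
    ∃ j, Accessible P i j ∧ IsRecurrentState P j := by
  classical
  obtain ⟨j, hj, hmin⟩ := exists_min_image ({j | Accessible P i j} : Finset (Fin n))
    (fun j => #{k | Accessible P j k}) ⟨i, by simpa using accessible_refl i⟩
  simp only [mem_filter_univ] at hj hmin
  refine ⟨j, hj, fun k hk => ?_⟩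
  have hsub : ({l | Accessible P k l} : Finset (Fin n)) ⊆
      ({l | Accessible P j l} : Finset (Fin n)) := fun l hl => by
    simp only [mem_filter_univ] at hl ⊢
    exact hk.trans hP hl
  have hmem : j ∈ ({l | Accessible P k l} : Finset (Fin n)) := by
    rw [eq_of_subset_of_card_le hsub (hmin k (hj.trans hP hk))]
    simpa using accessible_refl j
  simpa using hmem

lemma IsRecurrentClass.accessible (hP : P ∈ rowStochastic ℚ (Fin n)) {C : Finset (Fin n)}
    (hC : IsRecurrentClass P C) {j k : Fin n} (hj : j ∈ C) (hk : k ∈ C) : Accessible P j k := by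
  obtain ⟨i, -, h⟩ := hC
  exact ((h j).1 hj).2.trans hP ((h k).1 hk).1

lemma IsRecurrentClass.mem_of_pos (hP : P ∈ rowStochastic ℚ (Fin n)) {C : Finset (Fin n)}
    (hC : IsRecurrentClass P C) {j k : Fin n} (hj : j ∈ C) (hjk : 0 < P j k) : k ∈ C := by
  obtain ⟨i, hi, h⟩ := hC
  have hik : Accessible P i k := ((h j).1 hj).1.trans hP ⟨1, by simpa using hjk⟩
  exact (h k).2 ⟨hik, hi k hik⟩

lemma IsRecurrentState.exists_isRecurrentClass {i : Fin n} (hi : IsRecurrentState P i) :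
    ∃ C, IsRecurrentClass P C ∧ i ∈ C := by
  classical
  exact ⟨({j | Communicates P i j} : Finset (Fin n)), ⟨i, hi, by simp⟩,
    by simpa using ⟨accessible_refl i, accessible_refl i⟩⟩

lemma IsRecurrentClass.exists_isStationaryOn (hP : P ∈ rowStochastic ℚ (Fin n))
    {C : Finset (Fin n)} (hC : IsRecurrentClass P C) : ∃ π : C → ℝ, IsStationaryOn P C π := by
  have : Nonempty C := by
    obtain ⟨i, -, h⟩ := hC
    exact ⟨i, (h i).2 ⟨accessible_refl i, accessible_refl i⟩⟩
  refine exists_stationary (q := of fun i j : C => (P i j : ℝ)) (mem_rowStochastic_iff_sum.2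
    ⟨fun i j => Rat.cast_nonneg.2 (hP.1 i j), fun i => ?_⟩)
  have hsum : ∑ j, (P i j : ℝ) = 1 := by exact_mod_cast sum_row_of_mem_rowStochastic hP (i : Fin n)
  simp only [of_apply]
  rw [sum_coe_sort C fun j => (P i j : ℝ), ← hsum]
  refine sum_subset (subset_univ C) fun j _ hj => ?_
  have := mt (hC.mem_of_pos hP i.2) hj
  rw [(hP.1 i j).antisymm' (not_lt.1 this), Rat.cast_zero]

lemma rowDenom_pos (i : Fin n) : 0 < rowDenom P i :=
  Nat.pos_of_ne_zero (Finset.lcm_ne_zero_iff.2 fun _ _ => Rat.den_ne_zero _)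

lemma commonDenom_pos : 0 < commonDenom P :=
  Nat.pos_of_ne_zero (Finset.lcm_ne_zero_iff.2 fun _ _ => Rat.den_ne_zero _)

lemma rowDenom_le_commonDenom (i : Fin n) : rowDenom P i ≤ commonDenom P :=
  Nat.le_of_dvd commonDenom_pos <| Finset.lcm_dvd fun j _ =>
    Finset.dvd_lcm (f := fun ij : Fin n × Fin n => (P ij.1 ij.2).den) (mem_univ (i, j))

lemma exists_rowDenom_mul_eq_intCast (i j : Fin n) :
    ∃ z : ℤ, rowDenom P i * P.map (fun x : ℚ => (x : ℝ)) i j = z := by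
  obtain ⟨c, hc⟩ : (P i j).den ∣ rowDenom P i :=
    Finset.dvd_lcm (f := fun j => (P i j).den) (mem_univ j)
  refine ⟨c * (P i j).num, ?_⟩
  have h : (rowDenom P i : ℚ) * P i j = ((c * (P i j).num : ℤ) : ℚ) := by
    rw [hc]
    push_cast
    rw [← Rat.mul_den_eq_num (P i j)]
    ring
  rw [Matrix.map_apply]
  exact_mod_cast congrArg (Rat.cast : ℚ → ℝ) h

lemma card_compl_mul_inv_det_stopped_le (hP : P ∈ rowStochastic ℚ (Fin n)) {S : Finset (Fin n)}
    (hS : ReachableFrom (P.map fun x : ℚ => (x : ℝ)) S Set.univ) (hne : S.Nonempty) :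
    #Sᶜ * (stopped (P.map fun x : ℚ => (x : ℝ)) S).det⁻¹ ≤
      n * (min (denomProd P) (commonDenom P ^ (n - 1)) : ℕ) := by
  have hcard : #Sᶜ ≤ n - 1 := by
    rw [card_compl, Fintype.card_fin]
    exact Nat.sub_le_sub_left hne.card_pos n
  have hdet := inv_det_stopped_le_prod (cast_mem_rowStochastic hP) hS rowDenom_pos
    exists_rowDenom_mul_eq_intCast
  have hmin : ∏ i ∈ Sᶜ, rowDenom P i ≤ min (denomProd P) (commonDenom P ^ (n - 1)) := by
    refine le_min ?_ ?_
    · exact prod_le_prod_of_subset_of_one_le' (subset_univ _) fun i _ _ => rowDenom_pos i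
    · exact (prod_le_pow_card _ _ _ fun i _ => rowDenom_le_commonDenom i).trans
        (Nat.pow_le_pow_right commonDenom_pos hcard)
  refine mul_le_mul (Nat.cast_le.2 (hcard.trans (Nat.sub_le n 1)))
    (hdet.trans (by exact_mod_cast hmin)) ?_ (Nat.cast_nonneg n)
  exact inv_nonneg.2 (det_stopped_mem_Ioc (cast_mem_rowStochastic hP) hS).1.le

/-! ### Bounds for bias vectors -/

/-- On a set closed under transitions, a bias vector exceeds its values on a reachable `S`, in
absolute value, by at most `2‖r‖` times the bound on the expected hitting time of `S`. The same
holds after subtracting a constant `b` from the bias vector. -/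
lemma IsBias.abs_sub_le (hP : P ∈ rowStochastic ℚ (Fin n)) {r : Fin n → ℤ} {u : Fin n → ℝ}
    (hu : IsBias P r u) {A : Set (Fin n)} {S : Finset (Fin n)}
    (hA : ∀ i ∈ A, ∀ j, 0 < P i j → j ∈ A)
    (hS : ∀ i, ∃ s ∈ S, Accessible P i s) {b c : ℝ} (hs : ∀ i ∈ A, i ∈ S → |u i - b| ≤ c) :
    ∀ i ∈ A, |u i - b| ≤ c + 2 * ‖fun i => (r i : ℝ)‖ * n *
      (min (denomProd P) (commonDenom P ^ (n - 1)) : ℕ) := by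
  intro i hi
  have hp := cast_mem_rowStochastic hP
  obtain ⟨χ, hχ, hu⟩ := hu
  set p := P.map fun x : ℚ => (x : ℝ)
  set R := ‖fun i => (r i : ℝ)‖
  have hR : 0 ≤ R := norm_nonneg _
  have hS' : ReachableFrom p S Set.univ := fun i _ =>
    let ⟨s, hsS, his⟩ := hS i
    ⟨s, hsS, his.reflTransGen_cast hP⟩
  have hstep : ∀ i, |(u - b • 1) i - (p *ᵥ (u - b • 1)) i| ≤ 2 * R := fun i => by
    have h := abs_sub_gain_le hp hχ hu (R := R) (fun i => norm_le_pi_norm (fun i => (r i : ℝ)) i) i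
    rw [mulVec_sub, mulVec_smul, hp.2, hu]
    convert h using 2
    simp only [Pi.sub_apply, Pi.add_apply]
    ring
  have key := abs_le_add_of_abs_sub_mulVec_le (A := A) (S := S) (u := u - b • 1) (c := c) hp
    (fun i hi j hij => hA i hi j (Rat.cast_pos.1 hij)) hS' (by positivity : 0 ≤ 2 * R)
    (fun i hi hiS => by simpa using hs i hi hiS) (fun i _ _ => hstep i) i hi
  obtain ⟨s, hsS, -⟩ := hS i
  have hbound := card_compl_mul_inv_det_stopped_le hP hS' ⟨s, hsS⟩
  have := mul_le_mul_of_nonneg_left hbound (by positivity : 0 ≤ 2 * R)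
  simp only [Pi.sub_apply, Pi.smul_apply, Pi.one_apply, smul_eq_mul, mul_one] at key
  rw [mul_assoc (2 * R)]
  linarith

/-- If `u` averages to `0` on a recurrent class, its size there is at most its oscillation. -/
lemma IsBias.abs_le_of_mem_isRecurrentClass (hP : P ∈ rowStochastic ℚ (Fin n)) {r : Fin n → ℤ}
    {u : Fin n → ℝ} (hu : IsBias P r u) {C : Finset (Fin n)} (hC : IsRecurrentClass P C)
    {π : C → ℝ} (hπ : IsStationaryOn P C π) (h0 : ∑ i : C, u i * π i = 0) {s : Fin n}
    (hs : s ∈ C) :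
    |u s| ≤ 2 * ‖fun i => (r i : ℝ)‖ * n *
      (min (denomProd P) (commonDenom P ^ (n - 1)) : ℕ) := by
  have hosc : ∀ i ∈ C, |u i - u s| ≤ 0 + 2 * ‖fun i => (r i : ℝ)‖ * n *
      (min (denomProd P) (commonDenom P ^ (n - 1)) : ℕ) := by
    -- states outside `C` are put into the target, so that it is reachable from everywhere
    refine hu.abs_sub_le hP (A := C) (S := insert s Cᶜ) (fun i hi j => hC.mem_of_pos hP hi) ?_ ?_
    · intro i
      by_cases hi : i ∈ C
      · exact ⟨s, mem_insert_self _ _, hC.accessible hP hi hs⟩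
      · exact ⟨i, mem_insert_of_mem (mem_compl.2 hi), accessible_refl i⟩
    · intro i hi hiS
      rcases mem_insert.1 hiS with rfl | h
      · simp
      · exact absurd hi (mem_compl.1 h)
  simp only [zero_add] at hosc
  set B := 2 * ‖fun i => (r i : ℝ)‖ * n * (min (denomProd P) (commonDenom P ^ (n - 1)) : ℕ)
  obtain ⟨hπ0, hπ1⟩ := hπ.1
  calc |u s| = |∑ i : C, (u i - u s) * π i| := by
        simp only [sub_mul, sum_sub_distrib]
        rw [h0, ← mul_sum, hπ1, mul_one, zero_sub, abs_neg]
    _ ≤ ∑ i : C, |(u i - u s) * π i| := abs_sum_le_sum_abs _ _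
    _ ≤ ∑ i : C, B * π i := sum_le_sum fun i _ => by
        rw [abs_mul, abs_of_nonneg (hπ0 i)]
        exact mul_le_mul_of_nonneg_right (hosc i i.2) (hπ0 i)
    _ = B := by rw [← mul_sum, hπ1, mul_one]

end RationalChain

theorem theorem5 (n : ℕ) (P : Matrix (Fin n) (Fin n) ℚ)
    (hP : P ∈ Matrix.rowStochastic ℚ (Fin n)) (r : Fin n → ℤ) (u : Fin n → ℝ)
    (hu : IsBias P r u) :
    ((∀ C : Finset (Fin n), IsRecurrentClass P C → ∃ i ∈ C, u i = 0) →
      ‖u‖ ≤ 2 * ‖fun i => (r i : ℝ)‖ * n * (min (denomProd P) (commonDenom P ^ (n - 1)) : ℕ)) ∧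
    ((∀ C : Finset (Fin n), IsRecurrentClass P C →
        ∀ π : C → ℝ, IsStationaryOn P C π → ∑ i : C, u i * π i = 0) →
      ‖u‖ ≤ 4 * ‖fun i => (r i : ℝ)‖ * n * (min (denomProd P) (commonDenom P ^ (n - 1)) : ℕ)) := by
  have hRn : (0 : ℝ) ≤ ‖fun i => (r i : ℝ)‖ := norm_nonneg _
  constructor
  · intro hzero
    refine (pi_norm_le_iff_of_nonneg (by positivity)).2 fun i => ?_
    have h := hu.abs_sub_le hP (A := Set.univ) (S := univ.filter fun j => u j = 0) (b := 0)
      (c := 0) (fun _ _ _ _ => trivial) (fun i => ?_) (fun j _ hj => ?_) i trivial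
    · simpa using h
    · obtain ⟨j, hij, hj⟩ := exists_accessible_isRecurrentState hP i
      obtain ⟨C, hC, hjC⟩ := hj.exists_isRecurrentClass
      obtain ⟨k, hkC, hk⟩ := hzero C hC
      exact ⟨k, by simpa using hk, hij.trans hP (hC.accessible hP hjC hkC)⟩
    · simp [(mem_filter.1 hj).2]
  · intro hmean
    refine (pi_norm_le_iff_of_nonneg (by positivity)).2 fun i => ?_
    classical
    have h := hu.abs_sub_le hP (A := Set.univ) (S := univ.filter fun j => IsRecurrentState P j)
      (b := 0) (c := 2 * ‖fun i => (r i : ℝ)‖ * n *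
        (min (denomProd P) (commonDenom P ^ (n - 1)) : ℕ))
      (fun _ _ _ _ => trivial) (fun i => ?_) (fun j _ hj => ?_) i trivial
    · rw [sub_zero] at h
      rw [Real.norm_eq_abs]
      linarith
    · obtain ⟨j, hij, hj⟩ := exists_accessible_isRecurrentState hP i
      exact ⟨j, by simpa using hj, hij⟩
    · obtain ⟨C, hC, hjC⟩ := IsRecurrentState.exists_isRecurrentClass (mem_filter.1 hj).2
      obtain ⟨π, hπ⟩ := hC.exists_isStationaryOn hP
      rw [sub_zero]
      exact hu.abs_le_of_mem_isRecurrentClass hP hC hπ (hmean C hC π hπ) hjC
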